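/- Let $d\ge 1$, let $(\mathcal F_t)_{t\ge 0}$ be a right-continuous filtration on a probability space, and let $(X_t)_{t\ge 0}$ be an adapted process in $\mathbb R^d$ with stationary and independent increments whose paths are almost surely càdlàg (right-continuous with left limits). Let $f:[0,1]\to\mathbb R^d$ be a càdlàg function and $A\subseteq[0,1]$. For $\epsilon>0$ let $$V_{X+f}(A,\epsilon)=\mathrm{vol}\Big(\bigcup_{s\in A}\mathcal B(X_s+f(s),\epsilon)\Big)$$ be the volume of the $\epsilon$-sausage, where $\mathcal B(x,\epsilon)$ is the open ball of radius $\epsilon$ around $x$ and $\mathrm{vol}$ is Lebesgue measure on $\mathbb R^d$. For a bounded set $S\subseteq\mathbb R^d$ let $P(S,\epsilon)$ be the maximal number of pairwise disjoint balls of radius $\epsilon$ with centres in $S$, and let $$\overline{\dim}_M S=\limsup_{\epsilon\to0}\frac{\log P(S,\epsilon)}{\log(1/\epsilon)},\qquad \underline{\dim}_M S=\liminf_{\epsilon\to0}\frac{\log P(S,\epsilon)}{\log(1/\epsilon)}$$ be the upper and lower Minkowski dimensions of $S$ (with $\log 0=-\infty$, so that both are $-\infty$ for $S=\emptyset$). Then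 $V_{X+f}(A,\epsilon)$ is a random variable (measurable up to modification on a null set) for every $\epsilon>0$, and almost surely both $$\overline{\dim}_M (X+f)(A)=\limsup_{\epsilon\to0}\frac{\log \mathbb E[V_{X+f}(A,\epsilon)]}{\log(1/\epsilon)}+d$$ and $$\underline{\dim}_M (X+f)(A)=\liminf_{\epsilon\to0}\frac{\log \mathbb E[V_{X+f}(A,\epsilon)]}{\log(1/\epsilon)}+d .$$ -/

import Mathlib

open MeasureTheory ProbabilityTheory Filter Topology
open scoped NNReal ENNReal

/-- A càdlàg function: right-continuous at every point, with a left limit at every point. (At a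
least point of `T` the filter `𝓝[<] t` is trivial and the second condition is void; at a greatest
point the first one is void.) -/
def IsCadlag {T E : Type*} [TopologicalSpace T] [Preorder T] [TopologicalSpace E]
    (g : T → E) : Prop :=
  ∀ t : T, ContinuousWithinAt g (Set.Ici t) t ∧ ∃ l : E, Tendsto g (𝓝[<] t) (𝓝 l)

/-- Stationary increments: the law of `X (s + h) - X s` does not depend on `s`. -/
def HasStationaryIncrements {Ω E : Type*} [MeasurableSpace Ω] [MeasurableSpace E] [Sub E]
    (X : ℝ≥0 → Ω → E) (P : Measure Ω) : Prop :=
  ∀ s h : ℝ≥0, IdentDistrib (fun ω ↦ X (s + h) ω - X s ω) (fun ω ↦ X h ω - X 0 ω) P P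

/-- `P(S, ε)`: the maximal number of pairwise disjoint balls of radius `ε` with centres in `S`. -/
noncomputable def ballPackingNumber {E : Type*} [PseudoMetricSpace E] (S : Set E) (ε : ℝ) : ℕ∞ :=
  ⨆ (C : Finset E) (_ : (C : Set E) ⊆ S)
    (_ : (C : Set E).PairwiseDisjoint fun x ↦ Metric.ball x ε), (C.card : ℕ∞)

/-- Upper Minkowski dimension, `limsup_{ε → 0} log P(S, ε) / log (1 / ε)`, in `[-∞, ∞]`
(with `log 0 = -∞`, so that the empty set gets `-∞`). -/
noncomputable def upperMinkowskiDim {E : Type*} [PseudoMetricSpace E] (S : Set E) : EReal :=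
  limsup (fun ε : ℝ ↦
    ENNReal.log (ballPackingNumber S ε : ℝ≥0∞) / ((Real.log (1 / ε) : ℝ) : EReal)) (𝓝[>] 0)

/-- Lower Minkowski dimension, `liminf_{ε → 0} log P(S, ε) / log (1 / ε)`. -/
noncomputable def lowerMinkowskiDim {E : Type*} [PseudoMetricSpace E] (S : Set E) : EReal :=
  liminf (fun ε : ℝ ↦
    ENNReal.log (ballPackingNumber S ε : ℝ≥0∞) / ((Real.log (1 / ε) : ℝ) : EReal)) (𝓝[>] 0)

/-- `V_g(A, r) = vol (⋃_{s ∈ A} B(g(s), r))`, the volume of the sausage of radius `r` around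
the image `g(A)`. -/
noncomputable def sausageVolume {T : Type*} {d : ℕ} (g : T → EuclideanSpace ℝ (Fin d))
    (A : Set T) (r : ℝ) : ℝ≥0∞ :=
  volume (⋃ s ∈ A, Metric.ball (g s) r)

/-- The path `s ↦ X_s(ω) + f(s)`, `s ∈ [0,1]`. -/
def driftedPath {Ω : Type*} {d : ℕ} (X : ℝ≥0 → Ω → EuclideanSpace ℝ (Fin d))
    (f : unitInterval → EuclideanSpace ℝ (Fin d)) (ω : Ω) (s : unitInterval) :
    EuclideanSpace ℝ (Fin d) :=
  X (unitInterval.toNNReal s) ω + f s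

/-! A maximal `ε`-packing of a bounded set has, up to factors depending on `d`, as many balls as the
sausage volume divided by `ε ^ d` (`ballPackingNumber_image_bounds`). So both dimensions are `d`
plus the growth exponents of the random volume, and it remains to replace this volume by its mean up
to factors that are subpolynomial in `1 / ε`.

Markov's inequality and Borel–Cantelli bound the volume at radius `2⁻ⁿ` by `(n + 1) ^ 2` times its
mean. For the lower bound, the volume swept over a block of times depends only on the increments
inside the block. The volume added at one time is then independent of the sausage that follows, so
the second moment is at most twice the squared mean (`integral_sq_walkVolume_le`) and each block
reaches half its mean with probability at least `1 / 8`. Cutting the time set into `n` independent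
blocks makes a small total volume have probability at most `(7 / 8) ^ n`
(`measureReal_walkVolume_lt_le`), which is summable. The same estimate shows that the mean is
finite.

Right-continuity reduces `A` to a countable set of times, exhausted by finite ones. Monotonicity and
doubling in the radius pass from `2⁻ⁿ` to all `ε`. -/

section Deterministic

/-! ### Sausage volumes and packing numbers of a fixed path. -/

variable {T : Type*} {d : ℕ}

lemma sausageVolume_mono (g : T → EuclideanSpace ℝ (Fin d)) {A B : Set T} (h : A ⊆ B) (r : ℝ) :
    sausageVolume g A r ≤ sausageVolume g B r :=
  measure_mono (Set.biUnion_subset_biUnion_left h)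

lemma sausageVolume_mono_radius (g : T → EuclideanSpace ℝ (Fin d)) (A : Set T) {r r' : ℝ}
    (h : r ≤ r') : sausageVolume g A r ≤ sausageVolume g A r' :=
  measure_mono (Set.iUnion₂_mono fun _ _ ↦ Metric.ball_subset_ball h)

lemma sausageVolume_union_le (g : T → EuclideanSpace ℝ (Fin d)) (A B : Set T) (r : ℝ) :
    sausageVolume g (A ∪ B) r ≤ sausageVolume g A r + sausageVolume g B r := by
  unfold sausageVolume
  rw [Set.biUnion_union]
  exact measure_union_le _ _

@[simp] lemma sausageVolume_empty (g : T → EuclideanSpace ℝ (Fin d)) (r : ℝ) :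
    sausageVolume g ∅ r = 0 := by
  simp [sausageVolume]

lemma sausageVolume_singleton (g : T → EuclideanSpace ℝ (Fin d)) (s : T) (r : ℝ) :
    sausageVolume g {s} r = volume (Metric.ball (0 : EuclideanSpace ℝ (Fin d)) r) := by
  simp [sausageVolume, Measure.addHaar_ball_center]

lemma volume_ball_le_sausageVolume (g : T → EuclideanSpace ℝ (Fin d)) {A : Set T}
    (hA : A.Nonempty) (r : ℝ) :
    volume (Metric.ball (0 : EuclideanSpace ℝ (Fin d)) r) ≤ sausageVolume g A r := by
  obtain ⟨s, hs⟩ := hA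
  rw [← sausageVolume_singleton g s r]
  exact sausageVolume_mono g (by simpa using hs) r

lemma sausageVolume_sub_const (g : T → EuclideanSpace ℝ (Fin d)) (A : Set T) (r : ℝ)
    (c : EuclideanSpace ℝ (Fin d)) :
    sausageVolume (fun s ↦ g s - c) A r = sausageVolume g A r := by
  have h : (⋃ s ∈ A, Metric.ball (g s - c) r)
      = (fun x ↦ x + c) ⁻¹' (⋃ s ∈ A, Metric.ball (g s) r) := by
    ext x
    simp only [Set.mem_iUnion, Metric.mem_ball, Set.mem_preimage, dist_eq_norm, sub_sub_eq_add_sub]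
  unfold sausageVolume
  rw [h, measure_preimage_add_right]

lemma sausageVolume_congr {g g' : T → EuclideanSpace ℝ (Fin d)} {A : Set T}
    (h : ∀ s ∈ A, g s = g' s) (r : ℝ) : sausageVolume g A r = sausageVolume g' A r := by
  unfold sausageVolume
  congr 1
  exact Set.iUnion₂_congr fun s hs ↦ by rw [h s hs]

lemma sausageVolume_comp {T' : Type*} (g : T → EuclideanSpace ℝ (Fin d)) (t : T' → T)
    (A : Set T') (r : ℝ) :
    sausageVolume (fun i ↦ g (t i)) A r = sausageVolume g (t '' A) r := by
  unfold sausageVolume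
  rw [Set.biUnion_image]

lemma sausageVolume_lt_top_of_isBounded {g : T → EuclideanSpace ℝ (Fin d)} {A : Set T}
    (h : Bornology.IsBounded (g '' A)) (r : ℝ) : sausageVolume g A r < ∞ := by
  have : (⋃ s ∈ A, Metric.ball (g s) r) = Metric.thickening r (g '' A) := by
    rw [Metric.thickening_eq_biUnion_ball, Set.biUnion_image]
  unfold sausageVolume
  rw [this]
  exact h.thickening.measure_lt_top

lemma sausageVolume_lt_top_of_finite (g : T → EuclideanSpace ℝ (Fin d)) {A : Set T}
    (h : A.Finite) (r : ℝ) : sausageVolume g A r < ∞ :=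
  sausageVolume_lt_top_of_isBounded (h.image g).isBounded r

lemma measurable_sausageVolume {Ω : Type*} {mΩ : MeasurableSpace Ω}
    {Y : T → Ω → EuclideanSpace ℝ (Fin d)} (hY : ∀ s, Measurable (Y s)) {C : Set T}
    (hC : C.Countable) (r : ℝ) :
    Measurable fun ω ↦ sausageVolume (fun s ↦ Y s ω) C r := by
  have hS : MeasurableSet {p : Ω × EuclideanSpace ℝ (Fin d) | ∃ s ∈ C, dist p.2 (Y s p.1) < r} := by
    have : {p : Ω × EuclideanSpace ℝ (Fin d) | ∃ s ∈ C, dist p.2 (Y s p.1) < r}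
        = ⋃ s ∈ C, {p | dist p.2 (Y s p.1) < r} := by
      ext; simp
    rw [this]
    refine MeasurableSet.biUnion hC fun s _ ↦ ?_
    exact measurableSet_lt (measurable_snd.dist ((hY s).comp measurable_fst)) measurable_const
  convert measurable_measure_prodMk_left (ν := (volume : Measure (EuclideanSpace ℝ (Fin d)))) hS
    using 2 with ω
  unfold sausageVolume
  congr 1
  ext x
  simp

/-- A maximal family of disjoint balls: it realises the packing number, and the balls of twice
the radius cover. -/
lemma exists_finset_card_eq_ballPackingNumber {S : Set (EuclideanSpace ℝ (Fin d))} {ε : ℝ}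
    (hε : 0 < ε) (hS : volume (⋃ x ∈ S, Metric.ball x ε) ≠ ∞) :
    ∃ C : Finset (EuclideanSpace ℝ (Fin d)), ballPackingNumber S ε = C.card ∧
      C.card * volume (Metric.ball (0 : EuclideanSpace ℝ (Fin d)) ε)
        ≤ volume (⋃ x ∈ S, Metric.ball x ε) ∧
      ∀ s ∈ S, ∃ c ∈ C, dist s c < 2 * ε := by
  classical
  set v := volume (Metric.ball (0 : EuclideanSpace ℝ (Fin d)) ε) with hv
  have hv0 : v ≠ 0 := (Metric.measure_ball_pos _ _ hε).ne'
  have hvt : v ≠ ∞ := measure_ball_lt_top.ne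
  set V := volume (⋃ x ∈ S, Metric.ball x ε)
  let Adm : Finset (EuclideanSpace ℝ (Fin d)) → Prop := fun C ↦
    (C : Set (EuclideanSpace ℝ (Fin d))) ⊆ S ∧
      (C : Set (EuclideanSpace ℝ (Fin d))).PairwiseDisjoint fun x ↦ Metric.ball x ε
  have hcard : ∀ C, Adm C → C.card * v ≤ V := by
    rintro C ⟨h1, h2⟩
    calc C.card * v = ∑ x ∈ C, volume (Metric.ball x ε) := by
          simp [Measure.addHaar_ball_center, hv]
      _ = volume (⋃ x ∈ C, Metric.ball x ε) :=
          (measure_biUnion_finset h2 fun _ _ ↦ measurableSet_ball).symm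
      _ ≤ V := measure_mono (Set.biUnion_subset_biUnion_left h1)
  -- Finite sausage volume bounds the size of every packing, so the maximum is attained.
  obtain ⟨K, hK⟩ := ENNReal.exists_nat_gt (ENNReal.div_ne_top hS hv0)
  have hbd : ∀ C, Adm C → C.card ≤ K := by
    intro C hC
    have h1 : (C.card : ℝ≥0∞) ≤ V / v := by
      rw [ENNReal.le_div_iff_mul_le (Or.inl hv0) (Or.inl hvt)]
      exact hcard C hC
    exact_mod_cast (h1.trans_lt hK).le
  let Q : Set ℕ := {n | ∃ C, Adm C ∧ C.card = n}
  have hQ : Q.Nonempty := ⟨0, ∅, by simp [Adm], rfl⟩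
  have hQb : BddAbove Q := ⟨K, by rintro _ ⟨C, hC, rfl⟩; exact hbd C hC⟩
  obtain ⟨C, hC, hCm⟩ := Nat.sSup_mem hQ hQb
  have hmax : ∀ C', Adm C' → C'.card ≤ C.card := fun C' hC' ↦ by
    rw [hCm]; exact le_csSup hQb ⟨C', hC', rfl⟩
  refine ⟨C, le_antisymm ?_ ?_, hcard C hC, fun s hs ↦ ?_⟩
  · refine iSup_le fun C' ↦ iSup_le fun h1 ↦ iSup_le fun h2 ↦ ?_
    exact_mod_cast hmax C' ⟨h1, h2⟩
  · exact le_iSup_of_le C (le_iSup_of_le hC.1 (le_iSup_of_le hC.2 le_rfl))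
  -- A point at distance at least `2 * ε` from all centres could be added to the packing.
  · by_contra! hcon
    have hsC : s ∉ C := fun h ↦ by
      have := hcon s h
      rw [dist_self] at this
      linarith
    have : Adm (insert s C) := by
      constructor
      · rw [Finset.coe_insert]
        exact Set.insert_subset hs hC.1
      · rw [Finset.coe_insert]
        refine hC.2.insert fun c hc _ ↦ ?_
        exact Metric.ball_disjoint_ball (by linarith [hcon c hc])
    have := hmax _ this
    rw [Finset.card_insert_of_notMem hsC] at this
    omega

lemma sausageVolume_eq_image (g : T → EuclideanSpace ℝ (Fin d)) (A : Set T) (r : ℝ) :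
    sausageVolume g A r = volume (⋃ x ∈ g '' A, Metric.ball x r) := by
  rw [Set.biUnion_image]
  rfl

lemma volume_ball_mul (ε : ℝ) {k : ℝ} (hk : 0 < k) :
    volume (Metric.ball (0 : EuclideanSpace ℝ (Fin d)) (k * ε))
      = ENNReal.ofReal (k ^ d) * volume (Metric.ball (0 : EuclideanSpace ℝ (Fin d)) ε) := by
  rw [Measure.addHaar_ball_mul_of_pos _ _ hk, finrank_euclideanSpace_fin]

lemma sausageVolume_le_card_mul {g : T → EuclideanSpace ℝ (Fin d)} {A : Set T} {ε : ℝ}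
    {C : Finset (EuclideanSpace ℝ (Fin d))} (hC : ∀ s ∈ g '' A, ∃ c ∈ C, dist s c < 2 * ε)
    (ρ : ℝ) :
    sausageVolume g A ρ
      ≤ C.card * volume (Metric.ball (0 : EuclideanSpace ℝ (Fin d)) (ρ + 2 * ε)) := by
  rw [sausageVolume_eq_image]
  calc volume (⋃ x ∈ g '' A, Metric.ball x ρ)
      ≤ volume (⋃ c ∈ C, Metric.ball c (ρ + 2 * ε)) := by
        refine measure_mono (Set.iUnion₂_subset fun s hs y hy ↦ ?_)
        obtain ⟨c, hc, hcs⟩ := hC s hs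
        refine Set.mem_biUnion hc ?_
        rw [Metric.mem_ball] at hy ⊢
        linarith [dist_triangle y s c]
    _ ≤ ∑ c ∈ C, volume (Metric.ball c (ρ + 2 * ε)) := measure_biUnion_finset_le _ _
    _ = _ := by simp [Measure.addHaar_ball_center]

/-- The balls of radius `4 * ε` around a maximal `ε`-packing cover the larger sausage, while the
packing itself fits into the smaller one. The constant does not depend on the path, so the bound
passes to means. -/
lemma sausageVolume_two_mul_le (g : T → EuclideanSpace ℝ (Fin d)) (A : Set T) {ε : ℝ}
    (hε : 0 < ε) : sausageVolume g A (2 * ε) ≤ ENNReal.ofReal (4 ^ d) * sausageVolume g A ε := by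
  by_cases h : sausageVolume g A ε = ∞
  · rw [h, ENNReal.mul_top (by simp)]
    exact le_top
  obtain ⟨C, -, hC1, hC2⟩ := exists_finset_card_eq_ballPackingNumber hε
    (by rwa [sausageVolume_eq_image] at h)
  refine (sausageVolume_le_card_mul hC2 _).trans ?_
  rw [← two_mul, ← mul_assoc, show (2 * 2 : ℝ) = 4 by norm_num,
    volume_ball_mul _ (by norm_num : (0 : ℝ) < 4), mul_left_comm, sausageVolume_eq_image]
  gcongr

/-- Packing number and sausage volume determine each other up to a constant. -/
lemma ballPackingNumber_image_bounds {g : T → EuclideanSpace ℝ (Fin d)} {A : Set T} {ε : ℝ}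
    (hε : 0 < ε) (h : sausageVolume g A ε ≠ ∞) :
    ∃ N : ℕ, ballPackingNumber (g '' A) ε = N ∧
      N * volume (Metric.ball (0 : EuclideanSpace ℝ (Fin d)) ε) ≤ sausageVolume g A ε ∧
      sausageVolume g A ε
        ≤ N * (ENNReal.ofReal (3 ^ d) * volume (Metric.ball (0 : EuclideanSpace ℝ (Fin d)) ε)) := by
  obtain ⟨C, hC0, hC1, hC2⟩ := exists_finset_card_eq_ballPackingNumber hε
    (by rwa [sausageVolume_eq_image] at h)
  refine ⟨C.card, hC0, by rwa [sausageVolume_eq_image], ?_⟩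
  refine (sausageVolume_le_card_mul hC2 _).trans ?_
  rw [show ε + 2 * ε = 3 * ε by ring, volume_ball_mul _ (by norm_num : (0 : ℝ) < 3)]

end Deterministic

/-! ### Second moments and lower deviations for finitely many times. -/

section Walk

variable {Ω : Type*} {mΩ : MeasurableSpace Ω} {P : Measure Ω} {d : ℕ}

/-- The sausage volume of `Z a, …, Z (b - 1)` as a function of the increments of `Z`
with index in `S`. -/
noncomputable def incrementSausage (d a b : ℕ) (r : ℝ) (S : Finset ℕ)
    (x : S → EuclideanSpace ℝ (Fin d)) : ℝ≥0∞ :=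
  sausageVolume (fun i ↦ ∑ j ∈ Finset.Ico a i, if h : j ∈ S then x ⟨j, h⟩ else 0) (Set.Ico a b) r

lemma measurable_incrementSausage (d a b : ℕ) (r : ℝ) (S : Finset ℕ) :
    Measurable (incrementSausage d a b r S) := by
  refine measurable_sausageVolume (Y := fun i (x : S → EuclideanSpace ℝ (Fin d)) ↦
    ∑ j ∈ Finset.Ico a i, if h : j ∈ S then x ⟨j, h⟩ else 0) (fun i ↦ ?_)
    (Set.to_countable _) r
  refine Finset.measurable_fun_sum _ fun j _ ↦ ?_
  split_ifs with h
  · exact measurable_pi_apply _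
  · exact measurable_const

/-- Volume is translation invariant, so the starting point `z a` may be subtracted. The points `z a,
…, z (b - 1)` involve only the increments with indices `a, …, b - 2`. -/
lemma incrementSausage_increments (z : ℕ → EuclideanSpace ℝ (Fin d)) (a b : ℕ) (r : ℝ) :
    incrementSausage d a b r (Finset.Ico a (b - 1)) (fun i ↦ z (i + 1) - z i)
      = sausageVolume z (Set.Ico a b) r := by
  rw [← sausageVolume_sub_const z (Set.Ico a b) r (z a)]
  refine sausageVolume_congr (fun i hi ↦ ?_) r
  rw [Set.mem_Ico] at hi
  rw [← Finset.sum_Ico_sub z hi.1]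
  refine Finset.sum_congr rfl fun j hj ↦ ?_
  rw [Finset.mem_Ico] at hj
  rw [dif_pos (by rw [Finset.mem_Ico]; omega)]

variable {Z : ℕ → Ω → EuclideanSpace ℝ (Fin d)}

/-- Blocks sharing one time point still use disjoint sets of increments, whence `b ≤ c + 1` rather
than `b ≤ c`. -/
lemma indepFun_sausageVolume_Ico (hZ : ∀ i, Measurable (Z i))
    (hind : iIndepFun (fun i ω ↦ Z (i + 1) ω - Z i ω) P) {a b c e : ℕ} (hbc : b ≤ c + 1) (r : ℝ) :
    IndepFun (fun ω ↦ sausageVolume (fun i ↦ Z i ω) (Set.Ico a b) r)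
      (fun ω ↦ sausageVolume (fun i ↦ Z i ω) (Set.Ico c e) r) P := by
  have hdisj : Disjoint (Finset.Ico a (b - 1)) (Finset.Ico c (e - 1)) := by
    rw [Finset.disjoint_left]
    intro i hi hi'
    rw [Finset.mem_Ico] at hi hi'
    omega
  have := (hind.indepFun_finset _ _ hdisj fun i ↦ (hZ (i + 1)).sub (hZ i)).comp
    (measurable_incrementSausage d a b r _) (measurable_incrementSausage d c e r _)
  convert this using 1 <;>
  · ext ω
    exact (incrementSausage_increments (fun i ↦ Z i ω) _ _ r).symm

/-- The real-valued sausage volume of `z a, …, z (b - 1)`. -/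
noncomputable def walkVolume (z : ℕ → EuclideanSpace ℝ (Fin d)) (r : ℝ) (a b : ℕ) : ℝ :=
  (sausageVolume z (Set.Ico a b) r).toReal

lemma ofReal_walkVolume (z : ℕ → EuclideanSpace ℝ (Fin d)) (r : ℝ) (a b : ℕ) :
    ENNReal.ofReal (walkVolume z r a b) = sausageVolume z (Set.Ico a b) r :=
  ENNReal.ofReal_toReal (sausageVolume_lt_top_of_finite z (Set.finite_Ico a b) r).ne

lemma walkVolume_nonneg (z : ℕ → EuclideanSpace ℝ (Fin d)) (r : ℝ) (a b : ℕ) :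
    0 ≤ walkVolume z r a b := ENNReal.toReal_nonneg

@[simp] lemma walkVolume_self (z : ℕ → EuclideanSpace ℝ (Fin d)) (r : ℝ) (a : ℕ) :
    walkVolume z r a a = 0 := by
  simp [walkVolume]

lemma walkVolume_mono (z : ℕ → EuclideanSpace ℝ (Fin d)) (r : ℝ) {a b a' b' : ℕ}
    (ha : a' ≤ a) (hb : b ≤ b') : walkVolume z r a b ≤ walkVolume z r a' b' :=
  ENNReal.toReal_mono (sausageVolume_lt_top_of_finite z (Set.finite_Ico _ _) r).ne
    (sausageVolume_mono z (Set.Ico_subset_Ico ha hb) r)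

lemma walkVolume_le_add (z : ℕ → EuclideanSpace ℝ (Fin d)) (r : ℝ) {a b c : ℕ}
    (hab : a ≤ b) (hbc : b ≤ c) :
    walkVolume z r a c ≤ walkVolume z r a b + walkVolume z r b c := by
  unfold walkVolume
  rw [← ENNReal.toReal_add (sausageVolume_lt_top_of_finite z (Set.finite_Ico _ _) r).ne
    (sausageVolume_lt_top_of_finite z (Set.finite_Ico _ _) r).ne]
  refine ENNReal.toReal_mono (ENNReal.add_ne_top.2
    ⟨(sausageVolume_lt_top_of_finite z (Set.finite_Ico _ _) r).ne,
    (sausageVolume_lt_top_of_finite z (Set.finite_Ico _ _) r).ne⟩) ?_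
  rw [← Set.Ico_union_Ico_eq_Ico hab hbc]
  exact sausageVolume_union_le z _ _ r

lemma walkVolume_succ (z : ℕ → EuclideanSpace ℝ (Fin d)) (r : ℝ) (a : ℕ) :
    walkVolume z r a (a + 1)
      = (volume (Metric.ball (0 : EuclideanSpace ℝ (Fin d)) r)).toReal := by
  have : Set.Ico a (a + 1) = {a} := by ext; simp; omega
  rw [walkVolume, this, sausageVolume_singleton]

lemma walkVolume_le (z : ℕ → EuclideanSpace ℝ (Fin d)) (r : ℝ) (a n : ℕ) :
    walkVolume z r a (a + n)
      ≤ n * (volume (Metric.ball (0 : EuclideanSpace ℝ (Fin d)) r)).toReal := by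
  induction n with
  | zero => simp
  | succ n ih =>
    have h1 := walkVolume_le_add z r (Nat.le_add_right a n) (Nat.le_succ (a + n))
    rw [Nat.succ_eq_add_one, walkVolume_succ] at h1
    rw [← add_assoc]
    push_cast
    linarith

/-- With `u i` the volume up to `i`, the square `u b ^ 2` telescopes along `2 * u b * u i - u i ^
2`. Each difference is at most twice the newly added volume times `u b - u i`, and subadditivity
bounds the latter by the volume from `i` on. -/
lemma sq_walkVolume_le (z : ℕ → EuclideanSpace ℝ (Fin d)) (r : ℝ) {a b : ℕ} (hab : a ≤ b) :
    walkVolume z r a b ^ 2 ≤ 2 * ∑ i ∈ Finset.Ico a b,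
      (walkVolume z r a (i + 1) - walkVolume z r a i) * walkVolume z r i b := by
  set u : ℕ → ℝ := fun i ↦ walkVolume z r a i with hu
  have hua : u a = 0 := walkVolume_self z r a
  have htel : ∑ i ∈ Finset.Ico a b, ((2 * u b * u (i + 1) - u (i + 1) ^ 2)
      - (2 * u b * u i - u i ^ 2)) = u b ^ 2 := by
    rw [Finset.sum_Ico_sub (fun i ↦ 2 * u b * u i - u i ^ 2) hab, hua]
    ring
  change u b ^ 2 ≤ _
  rw [← htel, Finset.mul_sum]
  refine Finset.sum_le_sum fun i hi ↦ ?_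
  rw [Finset.mem_Ico] at hi
  have h1 : u b ≤ u i + walkVolume z r i b := walkVolume_le_add z r hi.1 hi.2.le
  have h2 : u i ≤ u (i + 1) := walkVolume_mono z r le_rfl (Nat.le_succ i)
  change _ ≤ 2 * ((u (i + 1) - u i) * walkVolume z r i b)
  nlinarith [mul_nonneg (sub_nonneg.2 h2) (sub_nonneg.2 h1), sq_nonneg (u (i + 1) - u i)]

lemma measurable_walkVolume (hZ : ∀ i, Measurable (Z i)) (r : ℝ) (a b : ℕ) :
    Measurable fun ω ↦ walkVolume (fun i ↦ Z i ω) r a b :=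
  (measurable_sausageVolume hZ (Set.to_countable _) r).ennreal_toReal

lemma norm_walkVolume_le (z : ℕ → EuclideanSpace ℝ (Fin d)) (r : ℝ) (a b : ℕ) :
    ‖walkVolume z r a b‖
      ≤ b * (volume (Metric.ball (0 : EuclideanSpace ℝ (Fin d)) r)).toReal := by
  rw [Real.norm_of_nonneg (walkVolume_nonneg z r a b)]
  have h1 := walkVolume_mono z r (Nat.zero_le a) (le_refl b)
  have h2 := walkVolume_le z r 0 b
  rw [zero_add] at h2
  exact h1.trans h2

lemma integral_walkVolume_mul (hZ : ∀ i, Measurable (Z i))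
    (hind : iIndepFun (fun i ω ↦ Z (i + 1) ω - Z i ω) P) {a b c e : ℕ} (hbc : b ≤ c + 1) (r : ℝ) :
    ∫ ω, walkVolume (fun i ↦ Z i ω) r a b * walkVolume (fun i ↦ Z i ω) r c e ∂P
      = (∫ ω, walkVolume (fun i ↦ Z i ω) r a b ∂P) * ∫ ω, walkVolume (fun i ↦ Z i ω) r c e ∂P :=
  ((indepFun_sausageVolume_Ico hZ hind (a := a) (e := e) hbc r).comp
    ENNReal.measurable_toReal ENNReal.measurable_toReal).integral_fun_mul_eq_mul_integral
    (measurable_walkVolume hZ r a b).aestronglyMeasurable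
    (measurable_walkVolume hZ r c e).aestronglyMeasurable

variable [IsProbabilityMeasure P]

lemma integrable_walkVolume (hZ : ∀ i, Measurable (Z i)) (r : ℝ) (a b : ℕ) :
    Integrable (fun ω ↦ walkVolume (fun i ↦ Z i ω) r a b) P :=
  .of_bound (measurable_walkVolume hZ r a b).aestronglyMeasurable _
    (ae_of_all _ fun _ ↦ norm_walkVolume_le _ r a b)

lemma integrable_walkVolume_mul (hZ : ∀ i, Measurable (Z i)) (r : ℝ) (a b c e : ℕ) :
    Integrable (fun ω ↦ walkVolume (fun i ↦ Z i ω) r a b * walkVolume (fun i ↦ Z i ω) r c e) P :=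
  (integrable_walkVolume hZ r c e).bdd_mul (measurable_walkVolume hZ r a b).aestronglyMeasurable
    (ae_of_all _ fun _ ↦ norm_walkVolume_le _ r a b)

/-- The volume that is new at time `i` is independent of the sausage from time `i` on; this bounds
the second moment of the sausage volume by twice the square of its mean. -/
lemma integral_sq_walkVolume_le (hZ : ∀ i, Measurable (Z i))
    (hind : iIndepFun (fun i ω ↦ Z (i + 1) ω - Z i ω) P) {a b : ℕ} (hab : a ≤ b) (r : ℝ) :
    ∫ ω, walkVolume (fun i ↦ Z i ω) r a b ^ 2 ∂P
      ≤ 2 * (∫ ω, walkVolume (fun i ↦ Z i ω) r a b ∂P) ^ 2 := by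
  set w : ℕ → ℕ → Ω → ℝ := fun a b ω ↦ walkVolume (fun i ↦ Z i ω) r a b with hw
  set m : ℕ → ℕ → ℝ := fun a b ↦ ∫ ω, w a b ω ∂P with hm
  have hint2 : ∀ a b c e, Integrable (fun ω ↦ w a b ω * w c e ω) P :=
    integrable_walkVolume_mul hZ r
  have hint : ∀ a b, Integrable (w a b) P := integrable_walkVolume hZ r
  have hterm : ∀ i, Integrable (fun ω ↦ (w a (i + 1) ω - w a i ω) * w i b ω) P := fun i ↦ by
    simp_rw [sub_mul]
    exact (hint2 _ _ _ _).sub (hint2 _ _ _ _)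
  calc ∫ ω, w a b ω ^ 2 ∂P
      ≤ ∫ ω, 2 * ∑ i ∈ Finset.Ico a b, (w a (i + 1) ω - w a i ω) * w i b ω ∂P := by
        refine integral_mono ?_ ((integrable_finsetSum _ fun i _ ↦ hterm i).const_mul 2)
          fun ω ↦ sq_walkVolume_le _ r hab
        simp_rw [pow_two]
        exact hint2 _ _ _ _
    _ = 2 * ∑ i ∈ Finset.Ico a b, (m a (i + 1) - m a i) * m i b := by
        rw [integral_const_mul, integral_finsetSum _ fun i _ ↦ hterm i]
        congr 1
        refine Finset.sum_congr rfl fun i _ ↦ ?_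
        simp_rw [sub_mul]
        rw [integral_sub (hint2 _ _ _ _) (hint2 _ _ _ _)]
        congr 1
        · exact integral_walkVolume_mul hZ hind le_rfl r
        · exact integral_walkVolume_mul hZ hind (Nat.le_succ i) r
    _ ≤ 2 * ∑ i ∈ Finset.Ico a b, (m a (i + 1) - m a i) * m a b := by
        gcongr with i hi
        · rw [sub_nonneg]
          exact integral_mono (hint _ _) (hint _ _) fun ω ↦
            walkVolume_mono _ r le_rfl (Nat.le_succ i)
        · exact integral_mono (hint _ _) (hint _ _) fun ω ↦
            walkVolume_mono _ r (Finset.mem_Ico.1 hi).1 le_rfl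
    _ = 2 * m a b ^ 2 := by
        rw [← Finset.sum_mul, Finset.sum_Ico_sub (m a) hab]
        simp [hm, hw, pow_two]

/-- On `p` this is AM-GM. With mean `m` and second moment at most `2 * m ^ 2`, integration gives `m
≤ m / 2 + m / 4 + 2 * m * ℙ(p)`, hence `ℙ(p) ≥ 1 / 8`. -/
lemma paleyZygmund_pointwise {x m : ℝ} (hm : 0 < m) (p : Prop) [Decidable p]
    (hp : ¬p → x < m / 2) : x ≤ m / 2 + x ^ 2 / (8 * m) + 2 * m * (if p then 1 else 0) := by
  have h8 : 0 ≤ x ^ 2 / (8 * m) := by positivity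
  split_ifs with h
  · have : x ^ 2 / (8 * m) + 2 * m - x = (x - 4 * m) ^ 2 / (8 * m) := by field_simp; ring
    have : 0 ≤ (x - 4 * m) ^ 2 / (8 * m) := by positivity
    linarith
  · linarith [hp h]

/-- A Paley–Zygmund inequality. -/
lemma measureReal_lt_half_integral_le {U : Ω → ℝ} (hU : Measurable U)
    (hU1 : Integrable U P) (hU2 : Integrable (fun ω ↦ U ω ^ 2) P) (hpos : 0 < ∫ ω, U ω ∂P)
    (h : ∫ ω, U ω ^ 2 ∂P ≤ 2 * (∫ ω, U ω ∂P) ^ 2) :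
    P.real {ω | U ω < (∫ ω, U ω ∂P) / 2} ≤ 7 / 8 := by
  classical
  set m := ∫ ω, U ω ∂P with hm
  have hS : MeasurableSet {ω | m / 2 ≤ U ω} := measurableSet_le measurable_const hU
  have hi1 : Integrable (fun ω ↦ m / 2 + U ω ^ 2 / (8 * m)) P :=
    (integrable_const _).add (hU2.div_const _)
  have hi2 : Integrable (fun ω ↦ 2 * m * {ω | m / 2 ≤ U ω}.indicator (fun _ ↦ (1 : ℝ)) ω) P :=
    ((integrable_const (1 : ℝ)).indicator hS).const_mul _
  have key : m ≤ ∫ ω, (m / 2 + U ω ^ 2 / (8 * m)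
      + 2 * m * {ω | m / 2 ≤ U ω}.indicator (fun _ ↦ (1 : ℝ)) ω) ∂P := by
    refine integral_mono hU1 (hi1.add hi2) fun ω ↦ ?_
    exact paleyZygmund_pointwise hpos (m / 2 ≤ U ω) fun h ↦ not_le.1 h
  rw [integral_add hi1 hi2, integral_add (integrable_const _) (hU2.div_const _),
    integral_const_mul, integral_indicator_const _ hS, integral_div (8 * m)] at key
  simp only [integral_const, probReal_univ, smul_eq_mul, one_mul, mul_one] at key
  have h3 : (∫ ω, U ω ^ 2 ∂P) / (8 * m) ≤ m / 4 := by
    rw [div_le_iff₀ (by positivity)]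
    nlinarith
  have h4 : (1 / 8 : ℝ) ≤ P.real {ω | m / 2 ≤ U ω} := by
    by_contra! hc
    nlinarith
  have h5 : {ω | U ω < m / 2} = {ω | m / 2 ≤ U ω}ᶜ := by ext; simp
  rw [h5, probReal_compl_eq_one_sub hS]
  linarith

/-- Splitting the index interval into `k` independent blocks, the probability that the sausage
volume falls below about `1 / (2 k)` of its mean is exponentially small in `k`. -/
lemma measureReal_walkVolume_lt_le (hZ : ∀ i, Measurable (Z i))
    (hind : iIndepFun (fun i ω ↦ Z (i + 1) ω - Z i ω) P) (r : ℝ) {α : ℝ} (hα : 0 < α) (k : ℕ)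
    {a b : ℕ} (hab : a ≤ b)
    (h : k * (α + (volume (Metric.ball (0 : EuclideanSpace ℝ (Fin d)) r)).toReal)
      ≤ ∫ ω, walkVolume (fun i ↦ Z i ω) r a b ∂P) :
    P.real {ω | walkVolume (fun i ↦ Z i ω) r a b < α / 2} ≤ (7 / 8) ^ k := by
  induction k generalizing a with
  | zero => simp
  | succ k ih =>
    set v := (volume (Metric.ball (0 : EuclideanSpace ℝ (Fin d)) r)).toReal with hv
    have hv0 : 0 ≤ v := ENNReal.toReal_nonneg
    set w : ℕ → ℕ → Ω → ℝ := fun a b ω ↦ walkVolume (fun i ↦ Z i ω) r a b with hw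
    have hint : ∀ a b, Integrable (w a b) P := integrable_walkVolume hZ r
    have hadd : ∀ {a b c}, a ≤ b → b ≤ c → ∫ ω, w a c ω ∂P
        ≤ ∫ ω, w a b ω ∂P + ∫ ω, w b c ω ∂P := fun {a b c} h1 h2 ↦ by
      rw [← integral_add (hint _ _) (hint _ _)]
      exact integral_mono (hint _ _) ((hint _ _).add (hint _ _)) fun ω ↦
        walkVolume_le_add _ r h1 h2
    push_cast at h
    have hk0 : 0 ≤ k * (α + v) := by positivity
    change _ ≤ ∫ ω, w a b ω ∂P at h
    have hb : α ≤ ∫ ω, w a b ω ∂P := by linarith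
    -- The first block ends as soon as its mean reaches `α`. One point adds at most `v` to the mean,
    -- so the block uses up at most `α + v` and the rest has mean at least `k * (α + v)`.
    have hex : ∃ c, a ≤ c ∧ α ≤ ∫ ω, w a c ω ∂P := ⟨b, hab, hb⟩
    classical
    obtain ⟨hac, hc⟩ := Nat.find_spec hex
    have hmin := fun c ↦ Nat.find_min hex (m := c)
    have hcb : Nat.find hex ≤ b := Nat.find_min' hex ⟨hab, hb⟩
    set c := Nat.find hex
    have hne : a ≠ c := by
      intro hh
      rw [← hh] at hc
      simp only [hw, walkVolume_self, integral_zero] at hc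
      linarith
    obtain ⟨e, he⟩ : ∃ e, c = e + 1 := ⟨c - 1, by omega⟩
    have he1 : ∫ ω, w a e ω ∂P < α := by
      have := hmin e (by omega)
      push Not at this
      exact this (by omega)
    have he2 : ∫ ω, w a c ω ∂P ≤ ∫ ω, w a e ω ∂P + v := by
      have h1 := hadd (show a ≤ e by omega) (show e ≤ c by omega)
      have h2 : ∫ ω, w e c ω ∂P = v := by
        rw [he]
        simp only [hw, walkVolume_succ, integral_const, probReal_univ, smul_eq_mul, one_mul, hv]
      linarith
    have h2 := hadd hac hcb
    have hrec := ih hcb (by change _ ≤ ∫ ω, w c b ω ∂P; linarith)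
    have hPZ : P.real {ω | w a c ω < α / 2} ≤ 7 / 8 := by
      refine (measureReal_mono fun ω hω ↦ ?_).trans (measureReal_lt_half_integral_le
        (measurable_walkVolume hZ r a c) (hint a c) ?_ (hα.trans_le hc)
        (integral_sq_walkVolume_le hZ hind hac r))
      · have hω' : w a c ω < α / 2 := hω
        change w a c ω < (∫ ω, w a c ω ∂P) / 2
        linarith
      · simp_rw [pow_two]
        exact integrable_walkVolume_mul hZ r a c a c
    have hindep : IndepFun (w a c) (w c b) P :=
      (indepFun_sausageVolume_Ico hZ hind (a := a) (e := b) (Nat.le_succ c) r).comp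
        ENNReal.measurable_toReal ENNReal.measurable_toReal
    -- If the whole sausage is small, so are both independent blocks.
    calc P.real {ω | w a b ω < α / 2}
        ≤ P.real (w a c ⁻¹' Set.Iio (α / 2) ∩ w c b ⁻¹' Set.Iio (α / 2)) := by
          refine measureReal_mono fun ω hω ↦ ⟨?_, ?_⟩
          · exact lt_of_le_of_lt (walkVolume_mono _ r le_rfl hcb) hω
          · exact lt_of_le_of_lt (walkVolume_mono _ r hac le_rfl) hω
      _ = P.real (w a c ⁻¹' Set.Iio (α / 2)) * P.real (w c b ⁻¹' Set.Iio (α / 2)) := by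
          simp only [measureReal_def]
          rw [hindep.measure_inter_preimage_eq_mul _ _ measurableSet_Iio measurableSet_Iio,
            ENNReal.toReal_mul]
      _ ≤ 7 / 8 * (7 / 8) ^ k := by
          gcongr
          · exact hPZ
          · exact hrec
      _ = (7 / 8) ^ (k + 1) := by ring

end Walk

/-! ### Concentration over countable time sets. -/

section Concentration

lemma Finset.exists_monotone_image_Ico_eq {T : Type*} [LinearOrder T] {F : Finset T}
    (hF : F.Nonempty) : ∃ (t : ℕ → T) (n : ℕ), Monotone t ∧ t '' Set.Ico 0 n = F := by
  have hc : 0 < F.card := hF.card_pos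
  -- The increasing enumeration of `F`, continued constantly so that it is monotone on all of `ℕ`.
  refine ⟨fun i ↦ F.orderEmbOfFin rfl ⟨min i (F.card - 1), by omega⟩, F.card, fun i j hij ↦ ?_, ?_⟩
  · refine (F.orderEmbOfFin rfl).monotone ?_
    rw [Fin.mk_le_mk]
    omega
  · rw [← F.range_orderEmbOfFin rfl]
    ext x
    constructor
    · rintro ⟨i, -, rfl⟩
      exact ⟨_, rfl⟩
    · rintro ⟨i, rfl⟩
      refine ⟨i, ⟨Nat.zero_le _, i.2⟩, ?_⟩
      refine congrArg _ (Fin.ext ?_)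
      exact min_eq_left (by omega)

variable {T Ω : Type*} [LinearOrder T] {mΩ : MeasurableSpace Ω} {P : Measure Ω}
  [IsProbabilityMeasure P] {d : ℕ} {Y : T → Ω → EuclideanSpace ℝ (Fin d)}

lemma measure_sausageVolume_finset_lt_le (hY : ∀ s, Measurable (Y s))
    (hind : HasIndepIncrements Y P) {F : Finset T} (hF : F.Nonempty) (r : ℝ) {α : ℝ} (hα : 0 < α)
    (k : ℕ)
    (h : ENNReal.ofReal (k * (α + (volume (Metric.ball (0 : EuclideanSpace ℝ (Fin d)) r)).toReal))
      ≤ ∫⁻ ω, sausageVolume (fun s ↦ Y s ω) F r ∂P) :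
    P {ω | sausageVolume (fun s ↦ Y s ω) F r < ENNReal.ofReal (α / 2)}
      ≤ ENNReal.ofReal ((7 / 8) ^ k) := by
  obtain ⟨t, n, ht, htF⟩ := Finset.exists_monotone_image_Ico_eq hF
  have hZ : ∀ i, Measurable (Y (t i)) := fun i ↦ hY _
  have hV : ∀ ω, sausageVolume (fun s ↦ Y s ω) F r
      = ENNReal.ofReal (walkVolume (fun i ↦ Y (t i) ω) r 0 n) := fun ω ↦ by
    rw [ofReal_walkVolume, sausageVolume_comp (fun s ↦ Y s ω) t, htF]
  simp_rw [hV] at h ⊢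
  rw [← ofReal_integral_eq_lintegral_ofReal (integrable_walkVolume hZ r 0 n)
    (ae_of_all _ fun ω ↦ walkVolume_nonneg _ r 0 n),
    ENNReal.ofReal_le_ofReal_iff (integral_nonneg fun ω ↦ walkVolume_nonneg _ r 0 n)] at h
  have := measureReal_walkVolume_lt_le hZ (hind.nat ht) r hα k (Nat.zero_le n) h
  rw [← ENNReal.ofReal_toReal (measure_ne_top P _)]
  refine ENNReal.ofReal_le_ofReal ?_
  simp_rw [ENNReal.ofReal_lt_ofReal_iff (half_pos hα)]
  exact this

/-- Lower deviations of the sausage volume over a countable set of times. -/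
lemma measure_sausageVolume_lt_le (hY : ∀ s, Measurable (Y s))
    (hind : HasIndepIncrements Y P) {C : Set T} (hC : C.Countable) (hCn : C.Nonempty) (r : ℝ)
    {α : ℝ} (hα : 0 < α) (k : ℕ)
    (h : ENNReal.ofReal (k * (α + (volume (Metric.ball (0 : EuclideanSpace ℝ (Fin d)) r)).toReal))
      < ∫⁻ ω, sausageVolume (fun s ↦ Y s ω) C r ∂P) :
    P {ω | sausageVolume (fun s ↦ Y s ω) C r < ENNReal.ofReal (α / 2)}
      ≤ ENNReal.ofReal ((7 / 8) ^ k) := by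
  classical
  obtain ⟨c, rfl⟩ := hC.exists_eq_range hCn
  let F : ℕ → Finset T := fun n ↦ (Finset.range (n + 1)).image c
  have hFmono : Monotone F := fun i j hij ↦
    Finset.image_subset_image (Finset.range_mono (Nat.add_le_add_right hij 1))
  have hFC : ∀ n, (F n : Set T) ⊆ Set.range c := fun n ↦ by
    simp only [F, Finset.coe_image]
    exact Set.image_subset_range _ _
  have hsup : ∀ ω, sausageVolume (fun s ↦ Y s ω) (Set.range c) r
      = ⨆ n, sausageVolume (fun s ↦ Y s ω) (F n) r := fun ω ↦ by
    have hU : (⋃ s ∈ Set.range c, Metric.ball (Y s ω) r)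
        = ⋃ n, ⋃ s ∈ (F n : Set T), Metric.ball (Y s ω) r := by
      ext x
      simp only [Set.mem_iUnion, F, Finset.coe_image, Set.mem_image, Set.mem_range, exists_prop]
      constructor
      · rintro ⟨_, ⟨n, rfl⟩, hx⟩
        exact ⟨n, c n, ⟨n, by simp, rfl⟩, hx⟩
      · rintro ⟨n, _, ⟨i, -, rfl⟩, hx⟩
        exact ⟨c i, ⟨i, rfl⟩, hx⟩
    unfold sausageVolume
    rw [hU, Monotone.measure_iUnion]
    exact fun i j hij ↦ Set.biUnion_subset_biUnion_left (Finset.coe_subset.2 (hFmono hij))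
  have hint : ∫⁻ ω, sausageVolume (fun s ↦ Y s ω) (Set.range c) r ∂P
      = ⨆ n, ∫⁻ ω, sausageVolume (fun s ↦ Y s ω) (F n) r ∂P := by
    simp_rw [hsup]
    exact lintegral_iSup (fun n ↦ measurable_sausageVolume hY (Finset.countable_toSet _) r)
      fun i j hij ω ↦ sausageVolume_mono _ (Finset.coe_subset.2 (hFmono hij)) r
  -- The strict inequality already holds for the mean over some finite subset, whose sausage is the
  -- smaller one.
  rw [hint, lt_iSup_iff] at h
  obtain ⟨n, hn⟩ := h
  refine (measure_mono fun ω hω ↦ ?_).trans (measure_sausageVolume_finset_lt_le hY hind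
    (F := F n) ⟨c 0, Finset.mem_image_of_mem c (by simp)⟩ r hα k hn.le)
  exact lt_of_le_of_lt (sausageVolume_mono _ (hFC n) r) hω

/-- If the sausage volume is almost surely finite, its mean is finite. -/
lemma lintegral_sausageVolume_ne_top (hY : ∀ s, Measurable (Y s))
    (hind : HasIndepIncrements Y P) {C : Set T} (hC : C.Countable) (hCn : C.Nonempty) (r : ℝ)
    (hfin : ∀ᵐ ω ∂P, sausageVolume (fun s ↦ Y s ω) C r ≠ ∞) :
    ∫⁻ ω, sausageVolume (fun s ↦ Y s ω) C r ∂P ≠ ∞ := by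
  intro htop
  have hzero : ∀ n : ℕ, P {ω | sausageVolume (fun s ↦ Y s ω) C r
      < ENNReal.ofReal ((n + 1 : ℝ) / 2)} = 0 := fun n ↦ by
    have hlim : Tendsto (fun k : ℕ ↦ ENNReal.ofReal ((7 / 8 : ℝ) ^ k)) atTop (𝓝 0) := by
      rw [← ENNReal.ofReal_zero]
      exact ENNReal.tendsto_ofReal
        (tendsto_pow_atTop_nhds_zero_of_lt_one (by norm_num) (by norm_num))
    -- An infinite mean can be cut into any number `k` of blocks.
    refine le_antisymm (ge_of_tendsto' hlim fun k ↦ ?_) bot_le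
    refine measure_sausageVolume_lt_le hY hind hC hCn r (by positivity) k ?_
    rw [htop]
    exact ENNReal.ofReal_lt_top
  have hall : ∀ᵐ ω ∂P, ∀ n : ℕ, ¬ sausageVolume (fun s ↦ Y s ω) C r
      < ENNReal.ofReal ((n + 1 : ℝ) / 2) :=
    ae_all_iff.2 fun n ↦ measure_eq_zero_iff_ae_notMem.1 (hzero n)
  obtain ⟨ω, h1, h2⟩ := (hfin.and hall).exists
  obtain ⟨n, hn⟩ := exists_nat_gt (2 * (sausageVolume (fun s ↦ Y s ω) C r).toReal)
  refine h2 n ?_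
  rw [← ENNReal.ofReal_toReal h1]
  exact (ENNReal.ofReal_lt_ofReal_iff (by positivity)).2 (by linarith)

/-- Almost surely the sausage volumes along a sequence of radii are eventually comparable to
their means, up to polynomial factors. -/
lemma ae_eventually_sausageVolume_bounds (hY : ∀ s, Measurable (Y s))
    (hind : HasIndepIncrements Y P) {C : Set T} (hC : C.Countable) (hCn : C.Nonempty)
    {r : ℕ → ℝ} (hr : ∀ n, 0 < r n)
    (hfin : ∀ n, ∫⁻ ω, sausageVolume (fun s ↦ Y s ω) C (r n) ∂P ≠ ∞) :
    ∀ᵐ ω ∂P, ∀ᶠ n : ℕ in atTop,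
      (∫⁻ ω', sausageVolume (fun s ↦ Y s ω') C (r n) ∂P).toReal
        ≤ 6 * n * (sausageVolume (fun s ↦ Y s ω) C (r n)).toReal ∧
      (sausageVolume (fun s ↦ Y s ω) C (r n)).toReal
        ≤ (n + 1) ^ 2 * (∫⁻ ω', sausageVolume (fun s ↦ Y s ω') C (r n) ∂P).toReal := by
  set V : ℕ → Ω → ℝ≥0∞ := fun n ω ↦ sausageVolume (fun s ↦ Y s ω) C (r n) with hV
  set m : ℕ → ℝ := fun n ↦ (∫⁻ ω, V n ω ∂P).toReal with hm
  set v : ℕ → ℝ :=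
    fun n ↦ (volume (Metric.ball (0 : EuclideanSpace ℝ (Fin d)) (r n))).toReal with hv
  have hv0 : ∀ n, 0 < v n := fun n ↦
    ENNReal.toReal_pos (Metric.measure_ball_pos _ _ (hr n)).ne' measure_ball_lt_top.ne
  have hvV : ∀ n ω, ENNReal.ofReal (v n) ≤ V n ω := fun n ω ↦ by
    rw [hv, ENNReal.ofReal_toReal measure_ball_lt_top.ne]
    exact volume_ball_le_sausageVolume _ hCn _
  have hmeas : ∀ n, Measurable (V n) := fun n ↦ measurable_sausageVolume hY hC _
  have hVfin : ∀ᵐ ω ∂P, ∀ n, V n ω < ∞ :=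
    ae_all_iff.2 fun n ↦ ae_lt_top (hmeas n) (hfin n)
  have hmv : ∀ n, v n ≤ m n := fun n ↦ by
    rw [hm, ← ENNReal.ofReal_le_iff_le_toReal (hfin n)]
    calc ENNReal.ofReal (v n) = ∫⁻ _, ENNReal.ofReal (v n) ∂P := by simp
      _ ≤ _ := lintegral_mono (hvV n)
  have hlow : ∀ n : ℕ, P {ω | 6 * n * V n ω < ENNReal.ofReal (m n)}
      ≤ ENNReal.ofReal ((7 / 8) ^ n) := fun n ↦ by
    rcases Nat.eq_zero_or_pos n with rfl | hn
    · simpa using prob_le_one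
    have hn' : (0 : ℝ) < n := by exact_mod_cast hn
    -- Chosen so that `n` blocks cost `m n / 2`, strictly less than the mean.
    set α := m n / (2 * n) - v n with hα
    have hαv : n * (α + v n) = m n / 2 := by rw [hα]; field_simp; ring
    have hred : ∀ ω, 6 * n * V n ω < ENNReal.ofReal (m n) →
        ∃ x : ℝ, V n ω = ENNReal.ofReal x ∧ v n ≤ x ∧ 3 * x < α + v n := by
      intro ω hω
      have hne : V n ω ≠ ∞ := by
        intro h
        rw [h, ENNReal.mul_top (by simp [hn.ne'])] at hω
        exact not_top_lt hω
      refine ⟨(V n ω).toReal, (ENNReal.ofReal_toReal hne).symm,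
        (ENNReal.ofReal_le_iff_le_toReal hne).1 (hvV n ω), ?_⟩
      rw [ENNReal.lt_ofReal_iff_toReal_lt (by finiteness)] at hω
      simp only [ENNReal.toReal_mul, ENNReal.toReal_ofNat, ENNReal.toReal_natCast] at hω
      have : α + v n = m n / (2 * n) := by rw [hα]; ring
      rw [this, lt_div_iff₀ (by positivity)]
      linarith
    -- A bad `ω` has volume `x ≥ v n` and `3 * x < α + v n`, hence `x < α / 2`. This is absurd for
    -- `α ≤ 0` and a lower deviation otherwise.
    rcases le_or_gt α 0 with h0 | h0
    · have : {ω | 6 * n * V n ω < ENNReal.ofReal (m n)} = ∅ := by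
        ext ω
        simp only [Set.mem_ofPred_eq, Set.mem_empty_iff_false, iff_false]
        intro hω
        obtain ⟨x, -, h1, h2⟩ := hred ω hω
        linarith [hv0 n]
      rw [this, measure_empty]
      exact bot_le
    · refine (measure_mono fun ω hω ↦ ?_).trans
        (measure_sausageVolume_lt_le hY hind hC hCn (r n) h0 n ?_)
      · obtain ⟨x, hx, h1, h2⟩ := hred ω hω
        change V n ω < _
        rw [hx]
        exact (ENNReal.ofReal_lt_ofReal_iff (half_pos h0)).2 (by linarith)
      · change ENNReal.ofReal (n * (α + v n)) < ∫⁻ ω, V n ω ∂P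
        rw [hαv, ← ENNReal.ofReal_toReal (hfin n)]
        exact (ENNReal.ofReal_lt_ofReal_iff ((hv0 n).trans_le (hmv n))).2
          (half_lt_self ((hv0 n).trans_le (hmv n)))
  have hup : ∀ n : ℕ, P {ω | ENNReal.ofReal ((n + 1) ^ 2 * m n) < V n ω}
      ≤ ENNReal.ofReal (1 / (n + 1) ^ 2) := fun n ↦ by
    have hmpos := (hv0 n).trans_le (hmv n)
    have h1 := meas_ge_le_lintegral_div (μ := P) (hmeas n).aemeasurable
      (ε := ENNReal.ofReal ((n + 1) ^ 2 * m n)) (ENNReal.ofReal_pos.2 (by positivity)).ne' ENNReal.ofReal_ne_top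
    refine (measure_mono fun ω hω ↦ ?_).trans (h1.trans_eq ?_)
    · have hω' : _ < V n ω := hω
      exact hω'.le
    · rw [← ENNReal.ofReal_toReal (hfin n), ← ENNReal.ofReal_div_of_pos (by positivity)]
      congr 1
      change m n / _ = _
      field_simp
  have hsum1 : ∑' n, P {ω | 6 * n * V n ω < ENNReal.ofReal (m n)} ≠ ∞ := by
    refine ne_top_of_le_ne_top ?_ (ENNReal.tsum_le_tsum hlow)
    exact (summable_geometric_of_lt_one (by norm_num) (by norm_num)).tsum_ofReal_ne_top
  have hsum2 : ∑' n, P {ω | ENNReal.ofReal ((n + 1) ^ 2 * m n) < V n ω} ≠ ∞ := by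
    refine ne_top_of_le_ne_top ?_ (ENNReal.tsum_le_tsum hup)
    have := (summable_nat_add_iff 1).2 (Real.summable_one_div_nat_pow.2 one_lt_two)
    push_cast at this
    exact this.tsum_ofReal_ne_top
  filter_upwards [ae_eventually_notMem hsum1, ae_eventually_notMem hsum2, hVfin]
    with ω h1 h2 h3
  filter_upwards [h1, h2] with n h4 h5
  rw [not_lt] at h4 h5
  constructor
  · have := ENNReal.toReal_mono (by have := (h3 n).ne; finiteness) h4
    rwa [ENNReal.toReal_ofReal (by positivity), ENNReal.toReal_mul, ENNReal.toReal_mul,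
      ENNReal.toReal_ofNat, ENNReal.toReal_natCast] at this
  · exact (ENNReal.toReal_mono ENNReal.ofReal_ne_top h5).trans_eq
      (ENNReal.toReal_ofReal (by positivity))

end Concentration

/-! ### Càdlàg paths and reduction to countably many times. -/

section Cadlag

/-- Near each point the values are close to the left limit or to the value there; compactness leaves
finitely many such neighbourhoods. -/
lemma IsCadlag.isBounded_image {T E : Type*} [TopologicalSpace T] [LinearOrder T]
    [PseudoMetricSpace E] {g : T → E} (hg : IsCadlag g) {K : Set T} (hK : IsCompact K) :
    Bornology.IsBounded (g '' K) := by
  refine hK.induction_on (p := fun s ↦ Bornology.IsBounded (g '' s)) (by simp)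
    (fun s t hst ht ↦ ht.subset (Set.image_mono hst))
    (fun s t hs ht ↦ by rw [Set.image_union]; exact hs.union ht) fun t _ ↦ ?_
  obtain ⟨hr, l, hl⟩ := hg t
  have h1 : g ⁻¹' Metric.ball (g t) 1 ∈ 𝓝[≥] t := hr (Metric.ball_mem_nhds _ one_pos)
  have h2 : g ⁻¹' Metric.ball l 1 ∈ 𝓝[<] t := hl (Metric.ball_mem_nhds _ one_pos)
  refine ⟨g ⁻¹' Metric.ball l 1 ∪ g ⁻¹' Metric.ball (g t) 1, mem_nhdsWithin_of_mem_nhds ?_, ?_⟩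
  · rw [← nhdsLT_sup_nhdsGE]
    exact union_mem_sup h2 h1
  · rw [Set.image_union]
    exact (Metric.isBounded_ball.subset (Set.image_preimage_subset _ _)).union
      (Metric.isBounded_ball.subset (Set.image_preimage_subset _ _))

/-- Subsets of a linear order are separable for the right-sided topology. -/
lemma exists_countable_right_dense_subset {T : Type*} [TopologicalSpace T] [LinearOrder T]
    [OrderTopology T] [SecondCountableTopology T] (A : Set T) :
    ∃ C ⊆ A, C.Countable ∧ ∀ s ∈ A, s ∉ C → ∀ u ∈ 𝓝[≥] s, (C ∩ u).Nonempty := by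
  obtain ⟨D, hDA, hDc, hD⟩ := (TopologicalSpace.IsSeparable.of_separableSpace
    A).exists_countable_dense_subset
  -- A dense set may miss points of `A` isolated from the right, but these are countably many. Any
  -- other point is approached from the right by `A`, hence by `D`.
  refine ⟨D ∪ {x ∈ A | 𝓝[A ∩ Set.Ioi x] x = ⊥}, Set.union_subset hDA fun x hx ↦ hx.1,
    hDc.union countable_setOfPred_isolated_right_within, ?_⟩
  intro s hs hsC u hu
  simp only [Set.mem_union, Set.mem_ofPred_eq, not_or, not_and] at hsC
  have : (𝓝[A ∩ Set.Ioi s] s).NeBot := ⟨hsC.2 hs⟩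
  obtain ⟨y, -, hy⟩ := Filter.nonempty_of_mem (self_mem_nhdsWithin (a := s) (s := A ∩ Set.Ioi s))
  obtain ⟨z, hz, hzu⟩ := (mem_nhdsGE_iff_exists_Ico_subset' hy).1 hu
  obtain ⟨w, ⟨hwA, hsw⟩, hwz⟩ := Filter.nonempty_of_mem (inter_mem
    (self_mem_nhdsWithin (a := s) (s := A ∩ Set.Ioi s)) (mem_nhdsWithin_of_mem_nhds (Iio_mem_nhds hz)))
  obtain ⟨q, hq, hqD⟩ := mem_closure_iff.1 (hD hwA) _ isOpen_Ioo ⟨hsw, hwz⟩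
  exact ⟨q, Or.inl hqD, hzu ⟨hq.1.le, hq.2⟩⟩

/-- Balls are open, so a point within `r` of `g s` is within `r` of `g q` for some `q ∈ C` just to
the right of `s`. -/
lemma sausageVolume_eq_of_right_dense {T : Type*} [TopologicalSpace T] [Preorder T] {d : ℕ}
    {g : T → EuclideanSpace ℝ (Fin d)} (hg : ∀ t, ContinuousWithinAt g (Set.Ici t) t)
    {A C : Set T} (hCA : C ⊆ A) (hC : ∀ s ∈ A, s ∉ C → ∀ u ∈ 𝓝[≥] s, (C ∩ u).Nonempty) (r : ℝ) :
    sausageVolume g A r = sausageVolume g C r := by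
  refine le_antisymm (measure_mono (Set.iUnion₂_subset fun s hs x hx ↦ ?_))
    (sausageVolume_mono g hCA r)
  by_cases hsC : s ∈ C
  · exact Set.mem_biUnion hsC hx
  · rw [Metric.mem_ball_comm] at hx
    obtain ⟨q, hqC, hq⟩ := hC s hs hsC _ (hg s (Metric.isOpen_ball.mem_nhds hx))
    refine Set.mem_biUnion hqC ?_
    rw [Metric.mem_ball_comm]
    exact hq

variable {Ω : Type*} {d : ℕ} {X : ℝ≥0 → Ω → EuclideanSpace ℝ (Fin d)}
  {f : unitInterval → EuclideanSpace ℝ (Fin d)}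

lemma unitInterval.monotone_toNNReal : Monotone unitInterval.toNNReal := fun _ _ h ↦ h

lemma continuousWithinAt_driftedPath (hf : IsCadlag f) {ω : Ω} (hX : IsCadlag fun t ↦ X t ω)
    (s : unitInterval) : ContinuousWithinAt (driftedPath X f ω) (Set.Ici s) s := by
  have h1 : ContinuousWithinAt (fun s ↦ X (unitInterval.toNNReal s) ω) (Set.Ici s) s :=
    (hX _).1.comp (t := Set.Ici (unitInterval.toNNReal s))
      unitInterval.toNNReal_continuous.continuousWithinAt
      fun t ht ↦ unitInterval.monotone_toNNReal ht
  exact h1.add (hf s).1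

lemma isBounded_image_driftedPath (hf : IsCadlag f) {ω : Ω} (hX : IsCadlag fun t ↦ X t ω)
    (A : Set unitInterval) : Bornology.IsBounded (driftedPath X f ω '' A) := by
  have h1 : Bornology.IsBounded ((fun t ↦ X t ω) '' Set.Icc 0 1) := hX.isBounded_image isCompact_Icc
  have h2 : Bornology.IsBounded (f '' Set.univ) := hf.isBounded_image isCompact_univ
  refine (h1.add h2).subset ?_
  rintro _ ⟨s, -, rfl⟩
  refine Set.add_mem_add ⟨unitInterval.toNNReal s, ⟨bot_le, s.2.2⟩, rfl⟩ ⟨s, trivial, rfl⟩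

lemma hasIndepIncrements_driftedPath {mΩ : MeasurableSpace Ω} {P : Measure Ω}
    (hX : HasIndepIncrements X P) :
    HasIndepIncrements (fun s ω ↦ driftedPath X f ω s) P := by
  refine hasIndepIncrements_iff_nat.2 fun t ht ↦ ?_
  have h1 := hX.nat (unitInterval.monotone_toNNReal.comp ht)
  have h2 := h1.comp (fun i x ↦ x + (f (t (i + 1)) - f (t i))) fun i ↦ measurable_add_const _
  convert h2 using 2 with i
  ext1 ω
  simp only [driftedPath, Function.comp_apply]
  abel

end Cadlag

/-! ### Logarithmic asymptotics as the radius tends to zero. -/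

section Asymptotics

lemma tendsto_log_one_div : Tendsto (fun ε : ℝ ↦ Real.log (1 / ε)) (𝓝[>] 0) atTop := by
  simp_rw [one_div]
  exact Real.tendsto_log_atTop.comp tendsto_inv_nhdsGT_zero

lemma tendsto_log_two_mul_add_one_div :
    Tendsto (fun x : ℝ ↦ Real.log (2 * x + 1) / x) atTop (𝓝 0) := by
  have h1 : Tendsto (fun x : ℝ ↦ 2 * x + 1) atTop atTop :=
    tendsto_atTop_add_const_right _ _ (tendsto_id.const_mul_atTop two_pos)
  have h2 := Real.isLittleO_log_id_atTop.tendsto_div_nhds_zero.comp h1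
  have h3 : Tendsto (fun x : ℝ ↦ 2 + x⁻¹) atTop (𝓝 (2 + 0)) :=
    tendsto_const_nhds.add tendsto_inv_atTop_zero
  have h4 := h2.mul h3
  rw [zero_mul] at h4
  refine h4.congr' ?_
  filter_upwards [eventually_gt_atTop 0] with x hx
  simp only [Function.comp_apply, id]
  field_simp

/-- Comparison along the radii `2⁻ⁿ`, up to a factor polynomial in `n`, extends to all radii. -/
lemma eventually_log_le_of_eventually_le {V m : ℝ → ℝ} {D : ℝ} (hD : 0 < D)
    (hV0 : ∀ ε, 0 < ε → 0 < V ε) (hm0 : ∀ ε, 0 < ε → 0 < m ε)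
    (hV : ∀ ε ε', 0 < ε → ε ≤ ε' → V ε ≤ V ε') (hm : ∀ ε ε', 0 < ε → ε ≤ ε' → m ε ≤ m ε')
    (hmD : ∀ ε, 0 < ε → m (2 * ε) ≤ D * m ε)
    (h : ∀ᶠ n : ℕ in atTop, V ((1 / 2) ^ n) ≤ 6 * (n + 1) ^ 2 * m ((1 / 2) ^ n)) :
    ∀ᶠ ε : ℝ in 𝓝[>] 0, Real.log (V ε)
      ≤ Real.log (m ε) + (Real.log (6 * D) + 2 * Real.log (2 * Real.log (1 / ε) + 1)) := by
  obtain ⟨N, hN⟩ := eventually_atTop.1 h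
  have hev : Set.Ioo (0 : ℝ) ((1 / 2) ^ N) ∈ 𝓝[>] (0 : ℝ) := Ioo_mem_nhdsGT (by positivity)
  filter_upwards [hev] with ε hε
  obtain ⟨h0, h1⟩ := hε
  have hle : ε ≤ 1 := h1.le.trans (pow_le_one₀ (by norm_num) (by norm_num))
  obtain ⟨n, hn1, hn2⟩ := exists_nat_pow_near_of_lt_one h0 hle
    (by norm_num : (0 : ℝ) < 1 / 2) (by norm_num)
  have hNn : N ≤ n := by
    have := (pow_lt_pow_iff_right_of_lt_one₀ (by norm_num : (0 : ℝ) < 1 / 2)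
      (by norm_num)).1 (hn1.trans h1)
    omega
  -- From `ε ≤ 2⁻ⁿ` and `log 2 > 1 / 2`; the polynomial factor thus costs only a doubly logarithmic
  -- term.
  have hnL : (n : ℝ) ≤ 2 * Real.log (1 / ε) := by
    have h2 := Real.log_le_log h0 hn2
    rw [Real.log_pow, one_div, Real.log_inv] at h2
    rw [one_div, Real.log_inv]
    have h3 := Real.log_two_gt_d9
    have h4 : (0 : ℝ) ≤ n := n.cast_nonneg
    nlinarith
  have hmain : V ε ≤ 6 * D * (n + 1) ^ 2 * m ε := by
    calc V ε ≤ V ((1 / 2) ^ n) := hV _ _ h0 hn2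
      _ ≤ 6 * (n + 1) ^ 2 * m ((1 / 2) ^ n) := hN n hNn
      _ ≤ 6 * (n + 1) ^ 2 * m (2 * ε) := by
          gcongr
          refine hm _ _ (by positivity) ?_
          rw [pow_succ] at hn1
          linarith
      _ ≤ 6 * (n + 1) ^ 2 * (D * m ε) := by
          gcongr
          exact hmD ε h0
      _ = _ := by ring
  have hlog := Real.log_le_log (hV0 ε h0) hmain
  have hm0' := (hm0 ε h0).ne'
  rw [Real.log_mul (by positivity) hm0', Real.log_mul (by positivity) (by positivity),
    Real.log_pow] at hlog
  have : Real.log (n + 1) ≤ Real.log (2 * Real.log (1 / ε) + 1) :=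
    Real.log_le_log (by positivity) (by linarith)
  push_cast at hlog
  linarith

/-- The comparison at dyadic radii is two-sided, so the extension to all radii is applied in both
directions; the error is of order `log (log (1 / ε))`. -/
lemma tendsto_log_sub_log_div_log {V m : ℝ → ℝ} {D : ℝ} (hD : 0 < D)
    (hV0 : ∀ ε, 0 < ε → 0 < V ε) (hm0 : ∀ ε, 0 < ε → 0 < m ε)
    (hV : ∀ ε ε', 0 < ε → ε ≤ ε' → V ε ≤ V ε') (hm : ∀ ε ε', 0 < ε → ε ≤ ε' → m ε ≤ m ε')
    (hVD : ∀ ε, 0 < ε → V (2 * ε) ≤ D * V ε) (hmD : ∀ ε, 0 < ε → m (2 * ε) ≤ D * m ε)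
    (h : ∀ᶠ n : ℕ in atTop, m ((1 / 2) ^ n) ≤ 6 * n * V ((1 / 2) ^ n) ∧
      V ((1 / 2) ^ n) ≤ (n + 1) ^ 2 * m ((1 / 2) ^ n)) :
    Tendsto (fun ε ↦ (Real.log (V ε) - Real.log (m ε)) / Real.log (1 / ε)) (𝓝[>] 0) (𝓝 0) := by
  have h1 := eventually_log_le_of_eventually_le hD hV0 hm0 hV hm hmD <| by
    filter_upwards [h] with n hn
    have := hm0 ((1 / 2) ^ n) (by positivity)
    have : 0 ≤ ((n : ℝ) + 1) ^ 2 * m ((1 / 2) ^ n) := by positivity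
    linarith [hn.2]
  have h2 := eventually_log_le_of_eventually_le hD hm0 hV0 hm hV hVD <| by
    filter_upwards [h] with n hn
    have := hV0 ((1 / 2) ^ n) (by positivity)
    refine hn.1.trans ?_
    gcongr
    nlinarith [n.cast_nonneg (α := ℝ)]
  have hB : Tendsto (fun x : ℝ ↦ (Real.log (6 * D) + 2 * Real.log (2 * x + 1)) / x) atTop
      (𝓝 0) := by
    have := (tendsto_id.const_div_atTop (Real.log (6 * D))).add
      (tendsto_log_two_mul_add_one_div.const_mul 2)
    rw [mul_zero, add_zero] at this
    refine this.congr fun x ↦ ?_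
    simp only [id]
    ring
  have hB' := hB.comp tendsto_log_one_div
  refine squeeze_zero_norm' ?_ hB'
  filter_upwards [h1, h2, tendsto_log_one_div.eventually_gt_atTop 0] with ε h3 h4 h5
  rw [Real.norm_eq_abs, abs_div, abs_of_pos h5]
  simp only [Function.comp_apply]
  gcongr
  rw [abs_le]
  constructor <;> linarith

lemma limsup_liminf_log_div_eq_add {a b : ℝ → ℝ≥0∞} {D : ℝ}
    (ha : ∀ ε, 0 < ε → a ε ≠ 0 ∧ a ε ≠ ∞) (hb : ∀ ε, 0 < ε → b ε ≠ 0 ∧ b ε ≠ ∞)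
    (h : Tendsto (fun ε ↦ (Real.log (a ε).toReal - Real.log (b ε).toReal) / Real.log (1 / ε))
      (𝓝[>] 0) (𝓝 D)) :
    limsup (fun ε : ℝ ↦ ENNReal.log (a ε) / ((Real.log (1 / ε) : ℝ) : EReal)) (𝓝[>] 0)
        = limsup (fun ε : ℝ ↦ ENNReal.log (b ε) / ((Real.log (1 / ε) : ℝ) : EReal)) (𝓝[>] 0) + D ∧
    liminf (fun ε : ℝ ↦ ENNReal.log (a ε) / ((Real.log (1 / ε) : ℝ) : EReal)) (𝓝[>] 0)
        = liminf (fun ε : ℝ ↦ ENNReal.log (b ε) / ((Real.log (1 / ε) : ℝ) : EReal)) (𝓝[>] 0)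
          + D := by
  set u : ℝ → EReal := fun ε ↦ ENNReal.log (b ε) / ((Real.log (1 / ε) : ℝ) : EReal) with hu
  set w : ℝ → EReal := fun ε ↦
    (((Real.log (a ε).toReal - Real.log (b ε).toReal) / Real.log (1 / ε) : ℝ) : EReal) with hw
  have hwD : Tendsto w (𝓝[>] 0) (𝓝 (D : EReal)) :=
    (continuous_coe_real_ereal.tendsto D).comp h
  have heq : (fun ε : ℝ ↦ ENNReal.log (a ε) / ((Real.log (1 / ε) : ℝ) : EReal))
      =ᶠ[𝓝[>] 0] u + w := by
    filter_upwards [self_mem_nhdsWithin] with ε hε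
    simp only [Pi.add_apply, hu, hw]
    rw [ENNReal.log_pos_real (ha ε hε).1 (ha ε hε).2, ENNReal.log_pos_real (hb ε hε).1 (hb ε hε).2,
      ← EReal.coe_div, ← EReal.coe_div, ← EReal.coe_add, ← add_div, add_sub_cancel]
  rw [limsup_congr heq, liminf_congr heq]
  have h1 : limsup w (𝓝[>] 0) = D := hwD.limsup_eq
  have h2 : liminf w (𝓝[>] 0) = D := hwD.liminf_eq
  constructor
  · refine le_antisymm ?_ ?_
    · rw [← h1]
      exact EReal.limsup_add_le (Or.inr (by simp [h1])) (Or.inr (by simp [h1]))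
    · rw [← h2]
      exact EReal.le_limsup_add
  · refine le_antisymm ?_ ?_
    · rw [← h1, add_comm u w, add_comm _ (limsup w _)]
      exact EReal.liminf_add_le (Or.inl (by simp [h1])) (Or.inl (by simp [h1]))
    · rw [← h2]
      exact EReal.le_liminf_add

/-- A ball of radius `ε` has volume `ε ^ d * c`, so the logarithms differ by `d * log (1 / ε)` up to
a bounded error. -/
lemma tendsto_log_ballPackingNumber_sub_div {T : Type*} {d : ℕ}
    {g : T → EuclideanSpace ℝ (Fin d)} {A : Set T} (hA : A.Nonempty)
    (hg : ∀ ε, sausageVolume g A ε ≠ ∞) :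
    (∀ ε, 0 < ε → (ballPackingNumber (g '' A) ε : ℝ≥0∞) ≠ 0 ∧
      (ballPackingNumber (g '' A) ε : ℝ≥0∞) ≠ ∞) ∧
    Tendsto (fun ε ↦ (Real.log (ballPackingNumber (g '' A) ε : ℝ≥0∞).toReal
      - Real.log (sausageVolume g A ε).toReal) / Real.log (1 / ε)) (𝓝[>] 0) (𝓝 d) := by
  set c := (volume (Metric.ball (0 : EuclideanSpace ℝ (Fin d)) 1)).toReal with hc
  have hc0 : 0 < c :=
    ENNReal.toReal_pos (Metric.measure_ball_pos _ _ one_pos).ne' measure_ball_lt_top.ne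
  have hball : ∀ ε, 0 < ε →
      (volume (Metric.ball (0 : EuclideanSpace ℝ (Fin d)) ε)).toReal = ε ^ d * c := by
    intro ε hε
    have := volume_ball_mul (d := d) 1 hε
    rw [mul_one] at this
    rw [this, ENNReal.toReal_mul, ENNReal.toReal_ofReal (by positivity)]
  have key : ∀ ε, 0 < ε → ∃ N : ℕ, 0 < N ∧ ballPackingNumber (g '' A) ε = N ∧
      N * (ε ^ d * c) ≤ (sausageVolume g A ε).toReal ∧
      (sausageVolume g A ε).toReal ≤ N * (3 ^ d * (ε ^ d * c)) := by
    intro ε hε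
    obtain ⟨N, hN, h1, h2⟩ := ballPackingNumber_image_bounds hε (hg ε)
    have hbt : volume (Metric.ball (0 : EuclideanSpace ℝ (Fin d)) ε) ≠ ∞ := measure_ball_lt_top.ne
    refine ⟨N, ?_, hN, ?_, ?_⟩
    · rw [Nat.pos_iff_ne_zero]
      rintro rfl
      rw [Nat.cast_zero, zero_mul, nonpos_iff_eq_zero] at h2
      exact ((Metric.measure_ball_pos volume _ hε).trans_le
        (volume_ball_le_sausageVolume g hA ε)).ne' h2
    · have := ENNReal.toReal_mono (hg ε) h1
      rwa [ENNReal.toReal_mul, ENNReal.toReal_natCast, hball ε hε] at this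
    · have := ENNReal.toReal_mono (by finiteness) h2
      rwa [ENNReal.toReal_mul, ENNReal.toReal_mul, ENNReal.toReal_natCast,
        ENNReal.toReal_ofReal (by positivity), hball ε hε] at this
  refine ⟨fun ε hε ↦ ?_, ?_⟩
  · obtain ⟨N, hN0, hN, -⟩ := key ε hε
    rw [hN]
    simp [hN0.ne']
  · have hdiff : Tendsto (fun ε : ℝ ↦ (Real.log (ballPackingNumber (g '' A) ε : ℝ≥0∞).toReal
        - Real.log (sausageVolume g A ε).toReal) / Real.log (1 / ε) - d) (𝓝[>] 0) (𝓝 0) := by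
      refine squeeze_zero_norm' (a := fun ε : ℝ ↦ (|Real.log c| + d * Real.log 3)
        / Real.log (1 / ε)) ?_ ((tendsto_id.const_div_atTop _).comp tendsto_log_one_div)
      filter_upwards [self_mem_nhdsWithin, tendsto_log_one_div.eventually_gt_atTop 0]
        with ε (hε : 0 < ε) hL
      obtain ⟨N, hN0, hN, h1, h2⟩ := key ε hε
      have hN0' : (0 : ℝ) < N := by exact_mod_cast hN0
      have hV0 : 0 < (sausageVolume g A ε).toReal := lt_of_lt_of_le (by positivity) h1
      have h3 := Real.log_le_log (by positivity) h1
      have h4 := Real.log_le_log hV0 h2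
      rw [Real.log_mul hN0'.ne' (by positivity), Real.log_mul (by positivity) hc0.ne',
        Real.log_pow] at h3
      rw [Real.log_mul hN0'.ne' (by positivity), Real.log_mul (by positivity) (by positivity),
        Real.log_mul (by positivity) hc0.ne', Real.log_pow, Real.log_pow] at h4
      rw [hN, div_sub' hL.ne', Real.norm_eq_abs, abs_div, abs_of_pos hL]
      gcongr
      rw [one_div, Real.log_inv]
      have h5 : ((N : ℕ∞) : ℝ≥0∞).toReal = N := by simp
      rw [h5, abs_le]
      have h6 := le_abs_self (Real.log c)
      have h7 := neg_abs_le (Real.log c)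
      have h8 : 0 ≤ d * Real.log 3 := by positivity
      constructor <;> linarith
    simpa using hdiff.add_const (d : ℝ)

end Asymptotics

/-! ### The main theorem. -/

theorem mainTheorem6 {Ω : Type*} {mΩ : MeasurableSpace Ω} (P : Measure Ω) [IsProbabilityMeasure P]
    {d : ℕ} (hd : 1 ≤ d)
    (ℱ : Filtration ℝ≥0 mΩ) (hℱ : ℱ.IsRightContinuous)
    (X : ℝ≥0 → Ω → EuclideanSpace ℝ (Fin d))
    (hX_adapted : Adapted ℱ X)
    (hX_cadlag : ∀ᵐ ω ∂P, IsCadlag fun t ↦ X t ω)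
    (hX_indep : HasIndepIncrements X P)
    (hX_stat : HasStationaryIncrements X P)
    (f : unitInterval → EuclideanSpace ℝ (Fin d)) (hf : IsCadlag f)
    (A : Set unitInterval) :
    (∀ ε : ℝ, 0 < ε → AEMeasurable (fun ω ↦ sausageVolume (driftedPath X f ω) A ε) P) ∧
    ∀ᵐ ω ∂P,
      upperMinkowskiDim (driftedPath X f ω '' A) =
        limsup (fun ε : ℝ ↦
          ENNReal.log (∫⁻ ω', sausageVolume (driftedPath X f ω') A ε ∂P) /
            ((Real.log (1 / ε) : ℝ) : EReal)) (𝓝[>] 0) + (d : EReal) ∧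
      lowerMinkowskiDim (driftedPath X f ω '' A) =
        liminf (fun ε : ℝ ↦
          ENNReal.log (∫⁻ ω', sausageVolume (driftedPath X f ω') A ε ∂P) /
            ((Real.log (1 / ε) : ℝ) : EReal)) (𝓝[>] 0) + (d : EReal) := by
  have hY : ∀ s, Measurable fun ω ↦ driftedPath X f ω s := fun s ↦
    ((hX_adapted _).mono (ℱ.le _) le_rfl).add_const _
  have hind : HasIndepIncrements (fun s ω ↦ driftedPath X f ω s) P :=
    hasIndepIncrements_driftedPath hX_indep
  obtain ⟨C, hCA, hCc, hC⟩ := exists_countable_right_dense_subset A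
  have hAC : ∀ᵐ ω ∂P, ∀ ε, sausageVolume (driftedPath X f ω) A ε
      = sausageVolume (driftedPath X f ω) C ε := by
    filter_upwards [hX_cadlag] with ω hω ε
    exact sausageVolume_eq_of_right_dense (continuousWithinAt_driftedPath hf hω) hCA hC ε
  have hmeas : ∀ ε, Measurable fun ω ↦ sausageVolume (driftedPath X f ω) C ε := fun ε ↦
    measurable_sausageVolume hY hCc ε
  refine ⟨fun ε _ ↦ ⟨_, hmeas ε, hAC.mono fun ω h ↦ h ε⟩, ?_⟩
  rcases A.eq_empty_or_nonempty with rfl | hA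
  · refine ae_of_all _ fun ω ↦ ?_
    have hpack : ∀ ε, ballPackingNumber (∅ : Set (EuclideanSpace ℝ (Fin d))) ε = 0 := fun ε ↦ by
      simp +contextual [ballPackingNumber, Set.subset_empty_iff]
    -- For empty `A` both sides are `⊥`; the quotient is `⊥` once `log (1 / ε)` is positive.
    have hbot : (fun ε : ℝ ↦ (⊥ : EReal) / ((Real.log (1 / ε) : ℝ) : EReal))
        =ᶠ[𝓝[>] 0] fun _ ↦ ⊥ := by
      filter_upwards [tendsto_log_one_div.eventually_gt_atTop 0] with ε hε
      exact EReal.bot_div_of_pos_ne_top (by exact_mod_cast hε) (EReal.coe_ne_top _)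
    simp only [upperMinkowskiDim, lowerMinkowskiDim, Set.image_empty, hpack, sausageVolume_empty,
      lintegral_zero, ENat.toENNReal_zero, ENNReal.log_zero]
    rw [limsup_congr hbot, liminf_congr hbot]
    simp
  have hCn : C.Nonempty := by
    obtain ⟨s, hs⟩ := hA
    by_cases hsC : s ∈ C
    · exact ⟨s, hsC⟩
    · exact (hC s hs hsC _ univ_mem).left
  have hfin : ∀ᵐ ω ∂P, ∀ ε, sausageVolume (driftedPath X f ω) C ε ≠ ∞ := by
    filter_upwards [hX_cadlag] with ω hω ε
    exact (sausageVolume_lt_top_of_isBounded (isBounded_image_driftedPath hf hω C) ε).ne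
  set m : ℝ → ℝ≥0∞ := fun ε ↦ ∫⁻ ω, sausageVolume (driftedPath X f ω) C ε ∂P with hm
  have hmA : ∀ ε, ∫⁻ ω, sausageVolume (driftedPath X f ω) A ε ∂P = m ε := fun ε ↦
    lintegral_congr_ae (hAC.mono fun ω h ↦ h ε)
  -- Paths are bounded on `[0,1]`, so the volume is almost surely finite, and this forces a finite
  -- mean.
  have hmtop : ∀ ε, m ε ≠ ∞ := fun ε ↦
    lintegral_sausageVolume_ne_top hY hind hCc hCn ε (hfin.mono fun ω h ↦ h ε)
  have hm0 : ∀ ε, 0 < ε → m ε ≠ 0 := fun ε hε ↦ by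
    refine ((Metric.measure_ball_pos volume (0 : EuclideanSpace ℝ (Fin d)) hε).trans_le ?_).ne'
    calc volume (Metric.ball (0 : EuclideanSpace ℝ (Fin d)) ε)
        = ∫⁻ _, volume (Metric.ball (0 : EuclideanSpace ℝ (Fin d)) ε) ∂P := by simp
      _ ≤ m ε := lintegral_mono fun ω ↦ volume_ball_le_sausageVolume _ hCn ε
  have hmmono : ∀ ε ε', 0 < ε → ε ≤ ε' → (m ε).toReal ≤ (m ε').toReal := fun ε ε' _ h ↦
    ENNReal.toReal_mono (hmtop _) (lintegral_mono fun ω ↦ sausageVolume_mono_radius _ _ h)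
  have hmdbl : ∀ ε, 0 < ε → (m (2 * ε)).toReal ≤ 4 ^ d * (m ε).toReal := fun ε hε ↦ by
    have h1 : m (2 * ε) ≤ ENNReal.ofReal (4 ^ d) * m ε := by
      rw [hm, ← lintegral_const_mul _ (hmeas ε)]
      exact lintegral_mono fun ω ↦ sausageVolume_two_mul_le _ C hε
    have h2 := ENNReal.toReal_mono (ENNReal.mul_ne_top ENNReal.ofReal_ne_top (hmtop ε)) h1
    rwa [ENNReal.toReal_mul, ENNReal.toReal_ofReal (by positivity)] at h2
  filter_upwards [hAC, hfin, ae_eventually_sausageVolume_bounds hY hind hCc hCn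
    (r := fun n ↦ (1 / 2) ^ n) (fun n ↦ by positivity) fun n ↦ hmtop _] with ω hω1 hω2 hω3
  have hV0 : ∀ ε, 0 < ε → 0 < (sausageVolume (driftedPath X f ω) C ε).toReal := fun ε hε ↦
    ENNReal.toReal_pos ((Metric.measure_ball_pos volume _ hε).trans_le
      (volume_ball_le_sausageVolume _ hCn ε)).ne' (hω2 ε)
  have hlim1 := tendsto_log_sub_log_div_log (V := fun ε ↦
      (sausageVolume (driftedPath X f ω) C ε).toReal) (m := fun ε ↦ (m ε).toReal)
    (D := 4 ^ d) (by positivity) hV0 (fun ε hε ↦ ENNReal.toReal_pos (hm0 ε hε) (hmtop ε))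
    (fun ε ε' _ h ↦ ENNReal.toReal_mono (hω2 _) (sausageVolume_mono_radius _ _ h)) hmmono
    (fun ε hε ↦ by
      have h2 := ENNReal.toReal_mono (ENNReal.mul_ne_top ENNReal.ofReal_ne_top (hω2 ε))
        (sausageVolume_two_mul_le (driftedPath X f ω) C hε)
      rwa [ENNReal.toReal_mul, ENNReal.toReal_ofReal (by positivity)] at h2) hmdbl hω3
  obtain ⟨hN, hlim2⟩ := tendsto_log_ballPackingNumber_sub_div hA
    (g := driftedPath X f ω) fun ε ↦ by rw [hω1]; exact hω2 ε
  simp_rw [hmA, upperMinkowskiDim, lowerMinkowskiDim]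
  refine limsup_liminf_log_div_eq_add hN (fun ε hε ↦ ⟨hm0 ε hε, hmtop ε⟩) (D := (d : ℝ)) ?_
  have := hlim2.add hlim1
  rw [add_zero] at this
  refine this.congr fun ε ↦ ?_
  rw [hω1, ← add_div, sub_add_sub_cancel]
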